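/- Let $A$ and $B$ be unital complex Banach algebras (complete, with submultiplicative norm and $\|e_A\|=\|e_B\|=1$). Suppose that $A$ is commutative and that $B$ is semisimple, i.e. its Jacobson radical is zero. Let $\mathfrak{A}$ be an open subgroup of the group $A^{-1}$ of invertible elements of $A$, and $\mathfrak{B}$ an open subgroup of the group $B^{-1}$ of invertible elements of $B$, all these groups being equipped with the metric induced by the norm. Suppose that $T:\mathfrak{A}\to\mathfrak{B}$ is a surjective isometry of metric spaces, i.e. $\|T(a)-T(b)\|=\|a-b\|$ for all $a,b\in\mathfrak{A}$ and $T(\mathfrak{A})=\mathfrak{B}$. Then the map $(T(e_A))^{-1}T$ extends to an isometric real-algebra isomorphism from $A$ onto $B$: there is a bijective, isometric, real-linear and multiplicative map $\Phi:A\to B$ with $\Phi(a)=(T(e_A))^{-1}T(a)$ for every $a\in\mathfrak{A}$. Moreover, $A$ is semisimple and $B$ is commutative. In particular, $A^{-1}$ and $B^{-1}$ are isometrically isomorphic as metrizable groups, i.e. there is a group isomorphism from $A^{-1}$ onto $B^{-1}$ that preserves the norm distance. -/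

import Mathlib

/-- A ring is semisimple in the sense of Banach algebra theory (also called Jacobson semisimple, or
semiprimitive) if its Jacobson radical, the intersection of its maximal left ideals, is zero. This
is weaker than Mathlib's `IsSemisimpleRing`, which includes the Artinian condition. -/
def JacobsonSemisimple (R : Type*) [Ring R] : Prop :=
  Ring.jacobson R = ⊥

/-! A Mazur–Ulam argument makes `T` preserve midpoints of segments inside `𝔄`. Since `𝔄` absorbs
nonzero complex scalars, `T` has a limit `u₀` along positive multiples of each element shrinking to
`0`, and `T - u₀` is additive along segments. On the convex cone generated by the unit ball about
`1` it is therefore the restriction of a real-linear isometry `L`. Complex extremality of `1` in the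
unit ball carries `T = L + u₀` over to all of `𝔄` (`exists_linearIsometryEquiv_add`). The scaling
invariance of `𝔅 - u₀` puts `u₀` into the radical, so `u₀ = 0`.

For multiplicativity, let `χ` be a character of `A`. The real-linear functional `b ↦ χ (L⁻¹ (L 1 *
b))` has no zeros on `𝔅`. A Gleason–Kahane–Żelazko theorem (`exists_algHom_of_ne_zero`) writes it as
`Re θ + iβ Im θ` with a character `θ` of `B`, and norm bounds force `β = ±1`. Thus it is
multiplicative. An element whose preimage is killed by every `χ` lies in the radical of `B`, hence
vanishes, and `(L 1)⁻¹ L` is an algebra isomorphism. -/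

open Set Metric Filter Topology

/-! ### Local Mazur–Ulam theorem -/

/-- If a metric space carries an isometric involution `R` that interchanges `x` and `y` and doubles
the distance to `z`, then every surjective self-isometry fixing `x` and `y` fixes `z`. -/
theorem IsometryEquiv.apply_eq_of_reflection {X : Type*} [MetricSpace X] {x y z : X} (R : X ≃ᵢ X)
    (hRz : R z = z) (hRx : R x = y) (hRy : R y = x) (hR : ∀ w, dist (R w) w = 2 * dist w z)
    (g : X ≃ᵢ X) (hx : g x = x) (hy : g y = y) : g z = z := by
  set s := { e : X ≃ᵢ X | e x = x ∧ e y = y }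
  have : Nonempty s := ⟨⟨IsometryEquiv.refl X, rfl, rfl⟩⟩
  have h_bdd : BddAbove (range fun e : s => dist ((e : X ≃ᵢ X) z) z) := by
    refine ⟨dist x z + dist x z, forall_mem_range.2 <| Subtype.forall.2 ?_⟩
    rintro e ⟨hx, _⟩
    calc
      dist (e z) z ≤ dist (e z) x + dist x z := dist_triangle (e z) x z
      _ = dist (e x) (e z) + dist x z := by rw [hx, dist_comm]
      _ = dist x z + dist x z := by rw [e.dist_eq x z]
  -- Väisälä's trick: `R e⁻¹ R e` stays in `s` and moves `z` twice as far as `e` does, so the finite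
  -- supremum `c` satisfies `2c ≤ c`.
  set f : X ≃ᵢ X → X ≃ᵢ X := fun e => ((e.trans R).trans e.symm).trans R
  have hf_dist : ∀ e, dist (f e z) z = 2 * dist (e z) z := by
    intro e
    have h : dist (f e z) z = dist (R (e.symm (R (e z)))) (R z) := by
      rw [hRz]; rfl
    rw [h, R.dist_eq, ← e.dist_eq, e.apply_symm_apply, hR]
  have hf_maps_to : MapsTo f s s := by
    rintro e ⟨hx, hy⟩
    constructor <;>
      simp [f, hRx, hRy, hx, hy, e.symm_apply_eq.2 hx.symm, e.symm_apply_eq.2 hy.symm]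
  set c := ⨆ e : s, dist ((e : X ≃ᵢ X) z) z
  have : c ≤ c / 2 := by
    apply ciSup_le
    rintro ⟨e, he⟩
    simp only [le_div_iff₀' (zero_lt_two' ℝ), ← hf_dist]
    exact le_ciSup h_bdd ⟨f e, hf_maps_to he⟩
  replace : c ≤ 0 := by linarith
  exact dist_le_zero.1 ((le_ciSup h_bdd ⟨g, hx, hy⟩).trans this)

section Normed

variable {E F : Type*} [NormedAddCommGroup E] [NormedAddCommGroup F]

/-- Point reflection in the midpoint of `x` and `y`, as an isometry of the intersection of two
balls of equal radius around `x` and `y`. -/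
noncomputable def lensReflection (x y : E) (ρ : ℝ) :
    (ball x ρ ∩ ball y ρ : Set E) ≃ᵢ (ball x ρ ∩ ball y ρ : Set E) :=
  have h : ∀ w ∈ ball x ρ ∩ ball y ρ, x + y - w ∈ ball x ρ ∩ ball y ρ := by
    rintro w ⟨h1, h2⟩
    rw [mem_ball, dist_eq_norm] at h1 h2
    refine ⟨?_, ?_⟩ <;> rw [mem_ball, dist_eq_norm]
    · rwa [show x + y - w - x = -(w - y) by abel, norm_neg]
    · rwa [show x + y - w - y = -(w - x) by abel, norm_neg]
  IsometryEquiv.mk'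
    (fun w => ⟨x + y - w, h w w.2⟩) (fun w => ⟨x + y - w, h w w.2⟩)
    (fun w => Subtype.ext (by simp))
    (Isometry.of_dist_eq fun a b => by
      rw [Subtype.dist_eq, Subtype.dist_eq]; exact dist_sub_left _ _ _)

@[simp]
theorem coe_lensReflection (x y : E) (ρ : ℝ) (w : (ball x ρ ∩ ball y ρ : Set E)) :
    (lensReflection x y ρ w : E) = x + y - w := rfl

variable [NormedSpace ℝ E] [NormedSpace ℝ F]

theorem dist_lensReflection (x y : E) (ρ : ℝ) (w z : (ball x ρ ∩ ball y ρ : Set E))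
    (hz : (z : E) = midpoint ℝ x y) :
    dist (lensReflection x y ρ w) w = 2 * dist w z := by
  rw [Subtype.dist_eq, Subtype.dist_eq, coe_lensReflection, hz, dist_eq_norm, dist_eq_norm,
    midpoint_eq_smul_add]
  have : x + y - (w : E) - w = (-2 : ℝ) • ((w : E) - (⅟2 : ℝ) • (x + y)) := by
    rw [smul_sub, smul_smul]
    norm_num
    module
  rw [this, norm_smul]
  norm_num

/-- Local form of the Mazur-Ulam theorem. -/
theorem map_midpoint_of_ball_subset {U : Set E} {V : Set F} {T : E → F}
    (hT : ∀ x ∈ U, ∀ y ∈ U, dist (T x) (T y) = dist x y) (hTV : T '' U = V)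
    {x y : E} {ρ : ℝ} (hρ : dist x y < ρ) (hx : ball x ρ ⊆ U) (hy : ball (T x) ρ ⊆ V) :
    T (midpoint ℝ x y) = midpoint ℝ (T x) (T y) := by
  have hρ0 : 0 < ρ := dist_nonneg.trans_lt hρ
  have hxU : x ∈ U := hx (mem_ball_self hρ0)
  have hyU : y ∈ U := hx (by rwa [mem_ball'])
  have hmap : ∀ w : (ball x ρ ∩ ball y ρ : Set E), T w ∈ ball (T x) ρ ∩ ball (T y) ρ := by
    rintro ⟨w, h1, h2⟩
    have hwU := hx h1
    exact ⟨by simpa [hT w hwU x hxU] using h1, by simpa [hT w hwU y hyU] using h2⟩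
  let e₀ : (ball x ρ ∩ ball y ρ : Set E) → (ball (T x) ρ ∩ ball (T y) ρ : Set F) :=
    fun w => ⟨T w, hmap w⟩
  have he₀ : Isometry e₀ := Isometry.of_dist_eq fun a b => by
    rw [Subtype.dist_eq, Subtype.dist_eq]
    exact hT a (hx a.2.1) b (hx b.2.1)
  have hsurj : Function.Surjective e₀ := by
    rintro ⟨w, h1, h2⟩
    have hw := hy h1
    rw [← hTV] at hw
    obtain ⟨a, ha, rfl⟩ := hw
    exact ⟨⟨a, by simpa [hT a ha x hxU] using h1, by simpa [hT a ha y hyU] using h2⟩, rfl⟩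
  let e : (ball x ρ ∩ ball y ρ : Set E) ≃ᵢ (ball (T x) ρ ∩ ball (T y) ρ : Set F) :=
    ⟨Equiv.ofBijective e₀ ⟨he₀.injective, hsurj⟩, he₀⟩
  let X : (ball x ρ ∩ ball y ρ : Set E) := ⟨x, mem_ball_self hρ0, by rwa [mem_ball]⟩
  let Y : (ball x ρ ∩ ball y ρ : Set E) := ⟨y, by rwa [mem_ball'], mem_ball_self hρ0⟩
  let Z : (ball x ρ ∩ ball y ρ : Set E) := ⟨midpoint ℝ x y, by
    have := dist_nonneg (x := x) (y := y)
    constructor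
    · rw [mem_ball, dist_midpoint_left]; norm_num; linarith
    · rw [mem_ball, dist_midpoint_right]; norm_num; linarith⟩
  have hadd : ∀ w : (ball x ρ ∩ ball y ρ : Set E), (e w : F) = T w := fun _ => rfl
  let R := lensReflection x y ρ
  let R' := lensReflection (T x) (T y) ρ
  have hRX : R X = Y := Subtype.ext (by simp [R, X, Y])
  have hRY : R Y = X := Subtype.ext (by simp [R, X, Y])
  have hRZ : R Z = Z := Subtype.ext (by
    simp only [R, coe_lensReflection, Z, midpoint_eq_smul_add]
    rw [sub_eq_iff_eq_add, ← two_smul ℝ, smul_smul]; norm_num)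
  have hR'X : R' (e X) = e Y := Subtype.ext (by simp [R', X, Y, hadd])
  have hR'Y : R' (e Y) = e X := Subtype.ext (by simp [R', X, Y, hadd])
  -- `R e⁻¹ R' e` fixes both endpoints, hence the midpoint; so `R'` fixes the image of the midpoint.
  have key := IsometryEquiv.apply_eq_of_reflection R hRZ hRX hRY
    (fun w => dist_lensReflection x y ρ w Z rfl) (((e.trans R').trans e.symm).trans R)
    (by simp [hR'X, hRY]) (by simp [hR'Y, hRX])
  simp only [IsometryEquiv.trans_apply] at key
  have h2 : e.symm (R' (e Z)) = Z := R.injective (key.trans hRZ.symm)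
  have h3 : R' (e Z) = e Z := e.symm_apply_eq.1 h2
  have h4 : T x + T y - T (midpoint ℝ x y) = T (midpoint ℝ x y) := congrArg Subtype.val h3
  rw [midpoint_eq_smul_add ℝ (T x), sub_eq_iff_eq_add.1 h4, ← two_smul ℝ, smul_smul]
  norm_num

/-- A surjective isometry between open sets preserves the midpoint of every segment contained in
its domain. -/
theorem map_midpoint_of_segment_subset {U : Set E} {V : Set F} (hU : IsOpen U) (hV : IsOpen V)
    {T : E → F} (hT : ∀ x ∈ U, ∀ y ∈ U, dist (T x) (T y) = dist x y) (hTV : T '' U = V)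
    {x y : E} (hxy : segment ℝ x y ⊆ U) :
    T (midpoint ℝ x y) = midpoint ℝ (T x) (T y) := by
  have hcomp : IsCompact (segment ℝ x y) := by
    rw [segment_eq_image_lineMap]
    exact isCompact_Icc.image AffineMap.lineMap_continuous
  have hcont : ContinuousOn T (segment ℝ x y) := by
    refine LipschitzOnWith.continuousOn (K := 1) (LipschitzOnWith.of_dist_le_mul ?_)
    intro a ha b hb
    simp [hT a (hxy ha) b (hxy hb)]
  obtain ⟨δ₁, hδ₁, h1⟩ := hcomp.exists_thickening_subset_open hU hxy
  obtain ⟨δ₂, hδ₂, h2⟩ := (hcomp.image_of_continuousOn hcont).exists_thickening_subset_open hV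
    (by rw [← hTV]; exact image_mono hxy)
  set δ := min δ₁ δ₂
  have hδ : 0 < δ := lt_min hδ₁ hδ₂
  have hloc : ∀ a ∈ segment ℝ x y, ∀ b, dist a b < δ →
      T (midpoint ℝ a b) = midpoint ℝ (T a) (T b) := by
    intro a ha b hab
    refine map_midpoint_of_ball_subset hT hTV hab (fun w hw => h1 ?_) (fun w hw => h2 ?_)
    · exact mem_thickening_iff.2 ⟨a, ha, (mem_ball.1 hw).trans_le (min_le_left _ _)⟩
    · exact mem_thickening_iff.2 ⟨T a, mem_image_of_mem _ ha,
        (mem_ball.1 hw).trans_le (min_le_right _ _)⟩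
  obtain ⟨M, hM⟩ := exists_nat_gt (dist x y / δ)
  have hM0 : (0 : ℝ) < M := (by positivity : 0 ≤ dist x y / δ).trans_lt hM
  rw [div_lt_iff₀ hδ] at hM
  -- An even number `2 * M` of steps makes the midpoint the grid point `p M`; points two steps apart
  -- are within `δ`, so the local result kills the second differences of `T ∘ p`.
  set p : ℕ → E := fun i => AffineMap.lineMap x y ((i : ℝ) / (2 * M)) with hp
  have hpm : ∀ i ≤ 2 * M, p i ∈ segment ℝ x y := by
    intro i hi
    rw [segment_eq_image_lineMap]
    refine ⟨_, ⟨by positivity, ?_⟩, rfl⟩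
    rw [div_le_one (by positivity)]
    exact_mod_cast hi
  have hmid : ∀ i, midpoint ℝ (p i) (p (i + 2)) = p (i + 1) := by
    intro i
    simp only [hp, midpoint_eq_smul_add, AffineMap.lineMap_apply_module]
    push_cast
    match_scalars <;> field_simp <;> norm_num <;> ring
  have hdist : ∀ i, dist (p i) (p (i + 2)) < δ := by
    intro i
    simp only [hp, dist_lineMap_lineMap]
    rw [Real.dist_eq, ← sub_div]
    push_cast
    rw [show (i : ℝ) - (i + 2) = -2 by ring, abs_div, abs_neg,
      abs_of_pos (by positivity : (0 : ℝ) < 2 * M), abs_two]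
    rw [div_mul_eq_mul_div, div_lt_iff₀ (by positivity)]
    nlinarith
  have hstep : ∀ i, i + 2 ≤ 2 * M → T (p (i + 2)) = (2 : ℝ) • T (p (i + 1)) - T (p i) := by
    intro i hi
    have := hloc (p i) (hpm i (by omega)) (p (i + 2)) (hdist i)
    rw [hmid, midpoint_eq_smul_add] at this
    rw [this, smul_smul]
    norm_num
  have hlin : ∀ i, i + 1 ≤ 2 * M → T (p i) = T (p 0) + (i : ℝ) • (T (p 1) - T (p 0)) ∧
      T (p (i + 1)) = T (p 0) + ((i : ℝ) + 1) • (T (p 1) - T (p 0)) := by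
    intro i
    induction i with
    | zero => intro _; simp
    | succ i ih =>
      intro hi
      obtain ⟨ih1, ih2⟩ := ih (by omega)
      refine ⟨by rw [ih2]; push_cast; rfl, ?_⟩
      rw [show i + 1 + 1 = i + 2 by ring, hstep i (by omega), ih1, ih2]
      push_cast
      module
  have hM1 : 1 ≤ M := by exact_mod_cast hM0
  have e0 : p 0 = x := by simp [hp]
  have eM : p M = midpoint ℝ x y := by
    simp only [hp, midpoint, invOf_eq_inv]
    congr 1
    field_simp
  have e2M : p (2 * M - 1 + 1) = y := by
    rw [Nat.sub_add_cancel (by omega)]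
    simp only [hp]
    push_cast
    rw [div_self (by positivity), AffineMap.lineMap_apply_one]
  have f1 := (hlin M (by omega)).1
  have f2 := (hlin (2 * M - 1) (by omega)).2
  rw [e2M, Nat.cast_sub (by omega)] at f2
  rw [eM] at f1
  rw [e0] at f1 f2
  rw [f1, f2, midpoint_eq_smul_add]
  push_cast
  rw [invOf_eq_inv]
  module

end Normed

/-! ### Open groups of units -/

section UnitGroups

variable {A : Type*} [NormedRing A]

/-- The underlying set of a group of units, as a subset of the algebra. -/
def Subgroup.unitsSet (G : Subgroup Aˣ) : Set A :=
  (fun g : Aˣ => (g : A)) '' (G : Set Aˣ)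

namespace Subgroup

variable {G : Subgroup Aˣ}

theorem one_mem_unitsSet : (1 : A) ∈ G.unitsSet := ⟨1, G.one_mem, rfl⟩

theorem mul_mem_unitsSet {a b : A} (ha : a ∈ G.unitsSet) (hb : b ∈ G.unitsSet) :
    a * b ∈ G.unitsSet := by
  obtain ⟨g, hg, rfl⟩ := ha
  obtain ⟨h, hh, rfl⟩ := hb
  exact ⟨g * h, G.mul_mem hg hh, by simp⟩

theorem isUnit_of_mem_unitsSet {a : A} (ha : a ∈ G.unitsSet) : IsUnit a := by
  obtain ⟨g, -, rfl⟩ := ha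
  exact g.isUnit

theorem exists_inv_mem_unitsSet {a : A} (ha : a ∈ G.unitsSet) :
    ∃ b ∈ G.unitsSet, a * b = 1 ∧ b * a = 1 := by
  obtain ⟨g, hg, rfl⟩ := ha
  exact ⟨_, ⟨g⁻¹, G.inv_mem hg, rfl⟩, by simp, by simp⟩

variable [CompleteSpace A]

theorem isOpen_unitsSet (hG : IsOpen (G : Set Aˣ)) : IsOpen G.unitsSet :=
  Units.isOpenEmbedding_val.isOpenMap _ hG

/-- An open group of units contains every connected set of units that it meets. -/
theorem subset_unitsSet_of_isPreconnected (hG : IsOpen (G : Set Aˣ)) {s : Set A}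
    (hs : IsPreconnected s) (hsu : ∀ x ∈ s, IsUnit x) (hne : (s ∩ G.unitsSet).Nonempty) :
    s ⊆ G.unitsSet := by
  -- An open subgroup is also closed, so `G` and its complement separate the units into two open
  -- sets.
  refine hs.subset_left_of_subset_union (isOpen_unitsSet hG)
    (v := (fun g : Aˣ => (g : A)) '' (G : Set Aˣ)ᶜ)
    (Units.isOpenEmbedding_val.isOpenMap _ (G.isClosed_of_isOpen hG).isOpen_compl) ?_ ?_ hne
  · exact (disjoint_image_iff Units.val_injective).2 disjoint_compl_right
  · intro x hx
    obtain ⟨g, rfl⟩ := hsu x hx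
    by_cases hg : g ∈ G
    · exact Or.inl ⟨g, hg, rfl⟩
    · exact Or.inr ⟨g, hg, rfl⟩

variable [NormedAlgebra ℂ A]

/-- The punctured complex plane is connected; over the reals, `-1` could be missed. -/
theorem smul_one_mem_unitsSet (hG : IsOpen (G : Set Aˣ)) {z : ℂ} (hz : z ≠ 0) :
    z • (1 : A) ∈ G.unitsSet := by
  have hc : IsPreconnected ({0}ᶜ : Set ℂ) :=
    (isConnected_compl_singleton_of_one_lt_rank (by simp) 0).isPreconnected
  refine subset_unitsSet_of_isPreconnected hG
    (hc.image (fun z : ℂ => z • (1 : A)) (by fun_prop)) ?_ ?_ (mem_image_of_mem _ hz)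
  · rintro _ ⟨w, hw, rfl⟩
    have := (IsUnit.mk0 w hw).map (algebraMap ℂ A)
    rwa [Algebra.algebraMap_eq_smul_one] at this
  · exact ⟨1, ⟨1, by simp, by simp⟩, one_mem_unitsSet⟩

theorem smul_mem_unitsSet (hG : IsOpen (G : Set Aˣ)) {z : ℂ} (hz : z ≠ 0) {a : A}
    (ha : a ∈ G.unitsSet) : z • a ∈ G.unitsSet := by
  have := mul_mem_unitsSet (smul_one_mem_unitsSet hG hz) ha
  rwa [smul_mul_assoc, one_mul] at this

theorem one_add_mem_unitsSet (hG : IsOpen (G : Set Aˣ)) {x : A} (hx : ‖x‖ < 1) :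
    1 + x ∈ G.unitsSet := by
  refine subset_unitsSet_of_isPreconnected hG (s := (fun x => 1 + x) '' ball 0 1)
    (((convex_ball (0 : A) 1).isPreconnected).image _ (by fun_prop)) ?_ ?_
    ⟨x, by simpa using hx, rfl⟩
  · rintro _ ⟨w, hw, rfl⟩
    have := (Units.oneSub (-w) (by simpa using hw)).isUnit
    simpa using this
  · exact ⟨1, ⟨0, by simp, by simp⟩, one_mem_unitsSet⟩

theorem smul_one_add_mem_unitsSet (hG : IsOpen (G : Set Aˣ)) {z : ℂ} {x : A} (hx : ‖x‖ < ‖z‖) :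
    z • (1 : A) + x ∈ G.unitsSet := by
  have hz : z ≠ 0 := norm_pos_iff.1 ((norm_nonneg x).trans_lt hx)
  have h := smul_mem_unitsSet hG hz (one_add_mem_unitsSet hG (x := z⁻¹ • x) (by
    rw [norm_smul, norm_inv, inv_mul_lt_iff₀ (norm_pos_iff.2 hz)]
    simpa using hx))
  rwa [smul_add, smul_smul, mul_inv_cancel₀ hz, one_smul] at h

end Subgroup

end UnitGroups

/-! ### Jacobson radical -/

section Jacobson

/-- An element `r` with `1 + x * r` a unit for all `x` vanishes if the Jacobson radical does. -/
theorem JacobsonSemisimple.eq_zero {R : Type*} [Ring R] (hR : JacobsonSemisimple R) {r : R}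
    (hr : ∀ x, IsUnit (1 + x * r)) : r = 0 := by
  have : r ∈ Ring.jacobson R := by
    rw [← Ideal.jacobson_bot, Ideal.mem_jacobson_iff]
    intro y
    obtain ⟨g, hg⟩ := hr y
    refine ⟨(g⁻¹ : Rˣ), ?_⟩
    have h : ((g⁻¹ : Rˣ) : R) * (1 + y * r) = 1 := by rw [← hg]; simp
    rw [mul_add, mul_one, ← mul_assoc] at h
    rw [add_comm, h, sub_self]
    exact Ideal.zero_mem _
  rwa [show Ring.jacobson R = ⊥ from hR, Submodule.mem_bot] at this

end Jacobson

/-! ### Complex extremality of the unit -/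

section ExtremePoint

variable {A : Type*} [NormedRing A] [NormedAlgebra ℂ A] [NormOneClass A]

/-- The unit is a complex extreme point of the unit ball of a unital normed algebra. -/
theorem eq_zero_of_norm_one_add_smul_le {d : A} {r : ℝ} (hr : 0 < r)
    (h : ∀ z : ℂ, ‖z‖ = r → ‖1 + z • d‖ ≤ 1) : d = 0 := by
  -- Cauchy's estimate for the derivative `n * d` of `(1 + z • d) ^ n` at `0`; the bound does not
  -- depend on `n`.
  have key : ∀ n : ℕ, (n : ℝ) * ‖d‖ ≤ 1 / r := by
    intro n
    have hd : Differentiable ℂ fun z : ℂ => 1 + z • d := by fun_prop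
    have hder : HasDerivAt (fun z : ℂ => (1 + z • d) ^ n) ((n : A) * d) 0 := by
      have h1 : HasDerivAt (fun z : ℂ => 1 + z • d) d 0 := by
        simpa using ((hasDerivAt_id (0 : ℂ)).smul_const d).const_add 1
      clear hd
      induction n with
      | zero => simpa using hasDerivAt_const (0 : ℂ) (1 : A)
      | succ n ih =>
        have := ih.mul h1
        simp only [pow_succ]
        convert! this using 1
        push_cast
        simp [add_mul]
    have := Complex.norm_deriv_le_of_forall_mem_sphere_norm_le (C := 1) hr
      (Differentiable.diffContOnCl (hd.pow n)) (c := 0) (fun z hz => by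
        refine (norm_pow_le _ n).trans (pow_le_one₀ (norm_nonneg _) (h z ?_))
        simpa using hz)
    rw [show deriv ((fun z : ℂ => 1 + z • d) ^ n) 0 = (n : A) * d from hder.deriv] at this
    rwa [← nsmul_eq_mul, ← Nat.cast_smul_eq_nsmul ℂ, norm_smul, Complex.norm_natCast] at this
  by_contra hne
  have hpos : 0 < ‖d‖ := norm_pos_iff.2 hne
  obtain ⟨n, hn⟩ := exists_nat_gt (1 / r / ‖d‖)
  rw [div_lt_iff₀ hpos] at hn
  exact absurd (key n) (not_le.2 hn)

end ExtremePoint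

/-! ### Extension to a real-linear isometry -/

section Extension

variable {A B : Type*} [NormedRing A] [NormedAlgebra ℂ A]
  [NormedRing B] [NormedAlgebra ℂ B]
  {G : Subgroup Aˣ} {H : Subgroup Bˣ}

theorem Subgroup.real_smul_mem_unitsSet [CompleteSpace A] (hG : IsOpen (G : Set Aˣ))
    {r : ℝ} (hr : r ≠ 0) {a : A}
    (ha : a ∈ G.unitsSet) : r • a ∈ G.unitsSet := by
  simpa using G.smul_mem_unitsSet hG (z := (r : ℂ)) (by exact_mod_cast hr) ha

/-- After subtraction of its limit at the origin, a surjective isometry between open groups of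
units commutes with division by two. -/
theorem exists_map_half_smul [CompleteSpace A] [CompleteSpace B]
    (hG : IsOpen (G : Set Aˣ)) (hH : IsOpen (H : Set Bˣ)) {T : A → B}
    (hT : ∀ x ∈ G.unitsSet, ∀ y ∈ G.unitsSet, dist (T x) (T y) = dist x y)
    (hTH : T '' G.unitsSet = H.unitsSet) :
    ∃ u₀ : B, ∀ a ∈ G.unitsSet, T ((1 / 2 : ℝ) • a) - u₀ = (1 / 2 : ℝ) • (T a - u₀) := by
  have hmem : ∀ {r : ℝ} (_ : 0 < r) {a : A}, a ∈ G.unitsSet → r • a ∈ G.unitsSet :=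
    fun hr _ ha => G.real_smul_mem_unitsSet hG hr.ne' ha
  have hpow : ∀ n : ℕ, (0 : ℝ) < (1 / 2) ^ n := fun n => by positivity
  have htend : Tendsto (fun n : ℕ => ((1 / 2 : ℝ)) ^ n) atTop (𝓝 0) :=
    tendsto_pow_atTop_nhds_zero_of_lt_one (by norm_num) (by norm_num)
  have hcau : CauchySeq fun n : ℕ => T (((1 / 2 : ℝ) ^ n) • (1 : A)) := by
    refine cauchySeq_of_le_geometric (1 / 2) ‖(1 : A)‖ (by norm_num) fun n => ?_
    rw [hT _ (hmem (hpow n) G.one_mem_unitsSet) _ (hmem (hpow (n + 1)) G.one_mem_unitsSet),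
      dist_eq_norm, ← sub_smul, norm_smul, pow_succ,
      show (1 / 2 : ℝ) ^ n - (1 / 2) ^ n * (1 / 2) = (1 / 2) ^ n * (1 / 2) by ring,
      Real.norm_of_nonneg (by positivity)]
    nlinarith [mul_nonneg (hpow n).le (norm_nonneg (1 : A))]
  obtain ⟨u₀, hu₀⟩ := cauchySeq_tendsto_of_complete hcau
  refine ⟨u₀, fun a ha => ?_⟩
  have hlim : Tendsto (fun n : ℕ => T (((1 / 2 : ℝ) ^ n) • a)) atTop (𝓝 u₀) := by
    refine (tendsto_iff_of_dist ?_).1 hu₀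
    have h : ∀ n : ℕ, dist (T (((1 / 2 : ℝ) ^ n) • (1 : A))) (T (((1 / 2 : ℝ) ^ n) • a)) =
        (1 / 2 : ℝ) ^ n * ‖1 - a‖ := fun n => by
      rw [hT _ (hmem (hpow n) G.one_mem_unitsSet) _ (hmem (hpow n) ha), dist_eq_norm, ← smul_sub,
        norm_smul, Real.norm_of_nonneg (hpow n).le]
    simp only [h]
    simpa using htend.mul_const ‖1 - a‖
  -- Zero is not in the domain, so the midpoint of `0` and `a` is reached as a limit along segments
  -- of positive multiples of `a`.
  have hmid : ∀ n : ℕ, T ((((1 / 2 : ℝ) ^ n + 1) / 2) • a) =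
      (1 / 2 : ℝ) • (T (((1 / 2 : ℝ) ^ n) • a) + T a) := by
    intro n
    have := map_midpoint_of_segment_subset (G.isOpen_unitsSet hG) (H.isOpen_unitsSet hH) hT hTH
      (x := ((1 / 2 : ℝ) ^ n) • a) (y := a) (by
        rintro _ ⟨s, t, hs, ht, hst, rfl⟩
        rw [smul_smul, ← add_smul]
        refine hmem ?_ ha
        rcases hs.eq_or_lt with rfl | hs'
        · rw [zero_add] at hst; simp [hst]
        · have := mul_pos hs' (hpow n)
          linarith)
    rw [midpoint_eq_smul_add, midpoint_eq_smul_add] at this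
    convert this using 2
    · rw [invOf_eq_inv]; module
    · rw [invOf_eq_inv]; norm_num
  have hl : Tendsto (fun n : ℕ => T ((((1 / 2 : ℝ) ^ n + 1) / 2) • a)) atTop
      (𝓝 (T ((1 / 2 : ℝ) • a))) := by
    rw [tendsto_iff_dist_tendsto_zero]
    have h : ∀ n : ℕ, dist (T ((((1 / 2 : ℝ) ^ n + 1) / 2) • a)) (T ((1 / 2 : ℝ) • a)) =
        (1 / 2 : ℝ) ^ n * (‖a‖ / 2) := fun n => by
      have hp := hpow n
      rw [hT _ (hmem (by positivity) ha) _ (hmem (by norm_num) ha), dist_eq_norm, ← sub_smul,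
        norm_smul, show ((1 / 2 : ℝ) ^ n + 1) / 2 - 1 / 2 = (1 / 2) ^ n / 2 by ring,
        Real.norm_of_nonneg (by positivity)]
      ring
    simp only [h]
    simpa using htend.mul_const (‖a‖ / 2)
  have hr : Tendsto (fun n : ℕ => (1 / 2 : ℝ) • (T (((1 / 2 : ℝ) ^ n) • a) + T a)) atTop
      (𝓝 ((1 / 2 : ℝ) • (u₀ + T a))) := (hlim.add_const _).const_smul _
  simp only [hmid] at hl
  rw [tendsto_nhds_unique hl hr]
  module

/-- A surjective isometry between open groups of units is, up to a translation, additive on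
segments. -/
theorem exists_map_add_of_segment_subset [CompleteSpace A] [CompleteSpace B]
    (hG : IsOpen (G : Set Aˣ)) (hH : IsOpen (H : Set Bˣ))
    {T : A → B} (hT : ∀ x ∈ G.unitsSet, ∀ y ∈ G.unitsSet, dist (T x) (T y) = dist x y)
    (hTH : T '' G.unitsSet = H.unitsSet) :
    ∃ u₀ : B, ∀ a b : A, segment ℝ a b ⊆ G.unitsSet →
      T (a + b) - u₀ = (T a - u₀) + (T b - u₀) := by
  obtain ⟨u₀, hu₀⟩ := exists_map_half_smul hG hH hT hTH
  refine ⟨u₀, fun a b hab => ?_⟩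
  have hmid := map_midpoint_of_segment_subset (G.isOpen_unitsSet hG) (H.isOpen_unitsSet hH) hT hTH
    hab
  have hm : midpoint ℝ a b ∈ G.unitsSet := hab (midpoint_mem_segment a b)
  have hsum : (2 : ℝ) • midpoint ℝ a b = a + b := by
    rw [midpoint_eq_smul_add, smul_smul]; norm_num
  have h := hu₀ _ (G.real_smul_mem_unitsSet hG (two_ne_zero' ℝ) hm)
  rw [smul_smul, hsum] at h
  norm_num at h
  rw [hmid, midpoint_eq_smul_add, invOf_eq_inv] at h
  have h2 : (2 : ℝ) • ((2⁻¹ : ℝ) • (T a + T b) - u₀) = T (a + b) - u₀ := by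
    rw [h, smul_smul]; norm_num
  rw [← h2]
  module

/-- The open convex cone generated by the open unit ball around the unit. -/
def unitCone (A : Type*) [NormedRing A] [NormedAlgebra ℂ A] : Set A :=
  {a | ∃ r : ℝ, ‖a - r • (1 : A)‖ < r}

theorem add_mem_unitCone {a b : A} (ha : a ∈ unitCone A) (hb : b ∈ unitCone A) :
    a + b ∈ unitCone A := by
  obtain ⟨r, hr⟩ := ha
  obtain ⟨s, hs⟩ := hb
  refine ⟨r + s, ?_⟩
  rw [show a + b - (r + s) • (1 : A) = (a - r • (1 : A)) + (b - s • (1 : A)) by module]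
  exact (norm_add_le _ _).trans_lt (add_lt_add hr hs)

theorem smul_mem_unitCone {a : A} (ha : a ∈ unitCone A) {t : ℝ} (ht : 0 < t) :
    t • a ∈ unitCone A := by
  obtain ⟨r, hr⟩ := ha
  refine ⟨t * r, ?_⟩
  rw [show t • a - (t * r) • (1 : A) = t • (a - r • (1 : A)) by module, norm_smul,
    Real.norm_of_nonneg ht.le]
  exact mul_lt_mul_of_pos_left hr ht

theorem segment_subset_unitCone {a b : A} (ha : a ∈ unitCone A) (hb : b ∈ unitCone A) :
    segment ℝ a b ⊆ unitCone A := by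
  rintro _ ⟨s, t, hs, ht, hst, rfl⟩
  rcases hs.eq_or_lt with rfl | hs
  · rw [zero_add] at hst; simpa [hst] using hb
  rcases ht.eq_or_lt with rfl | ht
  · rw [add_zero] at hst; simpa [hst] using ha
  exact add_mem_unitCone (smul_mem_unitCone ha hs) (smul_mem_unitCone hb ht)

theorem add_smul_one_mem_unitCone {x : A} {r : ℝ} (h : ‖x‖ < r) : x + r • (1 : A) ∈ unitCone A :=
  ⟨r, by simpa using h⟩

theorem unitCone_subset_unitsSet [CompleteSpace A] (hG : IsOpen (G : Set Aˣ)) :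
    unitCone A ⊆ G.unitsSet := by
  rintro a ⟨r, hr⟩
  have := G.smul_one_add_mem_unitsSet hG (z := (r : ℂ)) (x := a - r • (1 : A))
    (by rw [Complex.norm_real]; exact hr.trans_le (le_abs_self r))
  simpa using this

/-- An isometric map that is additive on segments agrees on the cone around the unit with a
linear isometry. -/
theorem exists_linearIsometry_of_map_add [CompleteSpace A] {S : A → B}
    (hG : IsOpen (G : Set Aˣ))
    (hS : ∀ x ∈ G.unitsSet, ∀ y ∈ G.unitsSet, dist (S x) (S y) = dist x y)
    (hadd : ∀ a b : A, segment ℝ a b ⊆ G.unitsSet → S (a + b) = S a + S b) :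
    ∃ L : A →ₗᵢ[ℝ] B, ∀ a ∈ unitCone A, S a = L a := by
  have haddK : ∀ a ∈ unitCone A, ∀ b ∈ unitCone A, S (a + b) = S a + S b := fun a ha b hb =>
    hadd a b ((segment_subset_unitCone ha hb).trans (unitCone_subset_unitsSet hG))
  -- Every `x` is a difference of two cone elements; `hf` shows that the choice of the two is
  -- immaterial.
  let f : A → B := fun x => S (x + (‖x‖ + 1) • (1 : A)) - S ((‖x‖ + 1) • (1 : A))
  have hone : ∀ {r : ℝ}, 0 < r → r • (1 : A) ∈ unitCone A := fun hr => by
    simpa using add_smul_one_mem_unitCone (x := (0 : A)) (by simpa using hr)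
  have hmemf : ∀ x : A, x + (‖x‖ + 1) • (1 : A) ∈ unitCone A := fun x =>
    add_smul_one_mem_unitCone (lt_add_one _)
  have hpos : ∀ x : A, 0 < ‖x‖ + 1 := fun x => by positivity
  have hf : ∀ k ∈ unitCone A, ∀ l ∈ unitCone A, f (k - l) = S k - S l := by
    intro k hk l hl
    have h1 := haddK _ (hmemf (k - l)) l hl
    have h2 := haddK k hk _ (hone (hpos (k - l)))
    rw [show k - l + (‖k - l‖ + 1) • (1 : A) + l = k + (‖k - l‖ + 1) • (1 : A) by abel, h2] at h1
    simp only [f]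
    rw [sub_eq_sub_iff_add_eq_add, ← h1]
  have hfadd : ∀ x y, f (x + y) = f x + f y := by
    intro x y
    have h := hf _ (add_mem_unitCone (hmemf x) (hmemf y)) _
      (add_mem_unitCone (hone (hpos x)) (hone (hpos y)))
    rw [haddK _ (hmemf x) _ (hmemf y), haddK _ (hone (hpos x)) _ (hone (hpos y)),
      show x + (‖x‖ + 1) • (1 : A) + (y + (‖y‖ + 1) • (1 : A)) -
        ((‖x‖ + 1) • (1 : A) + (‖y‖ + 1) • (1 : A)) = x + y by abel] at h
    rw [h]
    simp only [f]
    abel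
  have hfnorm : ∀ x, ‖f x‖ = ‖x‖ := by
    intro x
    simp only [f]
    rw [← dist_eq_norm, hS _ (unitCone_subset_unitsSet hG (hmemf x)) _
      (unitCone_subset_unitsSet hG (hone (hpos x))), dist_eq_norm, add_sub_cancel_right]
  let φ : A →+ B := AddMonoidHom.mk' f hfadd
  have hφ : Continuous φ := (AddMonoidHomClass.isometry_of_norm φ hfnorm).continuous
  refine ⟨⟨(φ.toRealLinearMap hφ : A →ₗ[ℝ] B), hfnorm⟩, fun a ha => ?_⟩
  have h := hf (a + a) (add_mem_unitCone ha ha) a ha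
  rw [haddK a ha a ha, add_sub_cancel_right, add_sub_cancel_right] at h
  exact h.symm

/-- A linear isometry that agrees on the cone around the unit with a surjective isometry between
open groups of units is surjective. -/
theorem surjective_of_eqOn_unitCone [NormOneClass A] [CompleteSpace B]
    (hH : IsOpen (H : Set Bˣ)) {T : A → B} {u₀ : B}
    (hT : ∀ x ∈ G.unitsSet, ∀ y ∈ G.unitsSet, dist (T x) (T y) = dist x y)
    (hTH : T '' G.unitsSet = H.unitsSet) (L : A →ₗᵢ[ℝ] B)
    (hL : ∀ a ∈ unitCone A, T a - u₀ = L a) : Function.Surjective L := by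
  have h1 : (1 : A) ∈ unitCone A := ⟨1, by simp⟩
  have hT1 : T 1 ∈ H.unitsSet := hTH ▸ mem_image_of_mem T G.one_mem_unitsSet
  obtain ⟨r, hr, hball⟩ := Metric.isOpen_iff.1 (H.isOpen_unitsSet hH) _ hT1
  -- A small perturbation of `T 1` is some `T k`; the bound `1` puts `k` in the cone, where `T - u₀`
  -- is `L`.
  have hsmall : ∀ w : B, ‖w‖ < min r 1 → ∃ x, L x = w := by
    intro w hw
    have hw' : T 1 + w ∈ T '' G.unitsSet := by
      rw [hTH]
      exact hball (by simpa using hw.trans_le (min_le_left _ _))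
    obtain ⟨k, hk, hkw⟩ := hw'
    have hd : ‖k - 1‖ < 1 := by
      rw [← dist_eq_norm, ← hT k hk 1 G.one_mem_unitsSet, hkw, dist_eq_norm, add_sub_cancel_left]
      exact hw.trans_le (min_le_right _ _)
    have hkK : k ∈ unitCone A := ⟨1, by simpa using hd⟩
    refine ⟨k - 1, ?_⟩
    rw [map_sub, ← hL k hkK, ← hL 1 h1, hkw]
    abel
  intro w
  have hm : 0 < min r 1 := lt_min hr one_pos
  set t : ℝ := min r 1 / (‖w‖ + 1)
  have ht : 0 < t := by positivity
  obtain ⟨x, hx⟩ := hsmall (t • w) (by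
    rw [norm_smul, Real.norm_of_nonneg ht.le, div_mul_eq_mul_div, div_lt_iff₀ (by positivity)]
    nlinarith)
  refine ⟨t⁻¹ • x, ?_⟩
  rw [map_smul, hx, smul_smul, inv_mul_cancel₀ ht.ne', one_smul]

/-- Propagation of agreement with a linear map from one complex direction `w` to all directions
at an angle of at most `π / 2` with it. -/
theorem eq_linear_of_inner_nonneg [CompleteSpace A] {S : A → B} (hG : IsOpen (G : Set Aˣ))
    (hadd : ∀ a b : A, segment ℝ a b ⊆ G.unitsSet → S (a + b) = S a + S b) (L : A →ₗᵢ[ℝ] B)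
    {w : ℂ} (hw : w ≠ 0) (hLw : ∀ t : ℝ, 0 < t → ∀ y : A, ‖y‖ < ‖(t : ℂ) * w‖ →
      S (((t : ℂ) * w) • (1 : A) + y) = L (((t : ℂ) * w) • (1 : A) + y))
    {z : ℂ} (hz : 0 ≤ (z * (starRingEnd ℂ) w).re) {y : A} (hy : ‖y‖ < ‖z‖) :
    S (z • (1 : A) + y) = L (z • (1 : A) + y) := by
  have hwpos : 0 < ‖w‖ := norm_pos_iff.2 hw
  -- For `t` this large, adding `z • 1 + y` to `(t * w) • 1` stays where `S = L` is known;
  -- additivity then gives the value at `z • 1 + y`.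
  obtain ⟨t, ht⟩ := exists_gt (‖z • (1 : A) + y‖ / ‖w‖)
  have ht0 : 0 < t := (by positivity : 0 ≤ ‖z • (1 : A) + y‖ / ‖w‖).trans_lt ht
  rw [div_lt_iff₀ hwpos] at ht
  have hnorm : ‖(t : ℂ) * w‖ = t * ‖w‖ := by
    rw [norm_mul, Complex.norm_real, Real.norm_of_nonneg ht0.le]
  have hseg : segment ℝ (z • (1 : A) + y) (((t : ℂ) * w) • (1 : A)) ⊆ G.unitsSet := by
    rintro _ ⟨p, q, hp, hq, hpq, rfl⟩
    have e : p • (z • (1 : A) + y) + q • (((t : ℂ) * w) • (1 : A)) =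
        ((p : ℂ) * z + q * (t * w)) • (1 : A) + p • y := by
      rw [smul_add, add_smul, mul_smul, mul_smul, mul_smul, mul_smul]
      simp only [Complex.coe_smul]
      abel
    rw [e]
    apply G.smul_one_add_mem_unitsSet hG
    rw [norm_smul, Real.norm_of_nonneg hp]
    -- The angle condition makes the cross term nonnegative, so the scalar part dominates `p * ‖y‖`.
    have hsq : (p * ‖z‖) ^ 2 + (q * (t * ‖w‖)) ^ 2 ≤ ‖(p : ℂ) * z + q * (t * w)‖ ^ 2 := by
      rw [← Complex.normSq_eq_norm_sq, Complex.normSq_add]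
      simp only [map_mul, Complex.normSq_eq_norm_sq, Complex.conj_ofReal, Complex.norm_real,
        Real.norm_eq_abs, sq_abs]
      have : ((p : ℂ) * z * (q * (t * (starRingEnd ℂ) w))).re =
          p * q * t * (z * (starRingEnd ℂ) w).re := by
        rw [show (p : ℂ) * z * (q * (t * (starRingEnd ℂ) w)) =
          ((p * q * t : ℝ) : ℂ) * (z * (starRingEnd ℂ) w) by push_cast; ring, Complex.re_ofReal_mul]
      rw [this]
      have : 0 ≤ p * q * t * (z * (starRingEnd ℂ) w).re := by positivity
      nlinarith
    rcases hp.eq_or_lt with rfl | hp'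
    · have hq1 : q = 1 := by linarith
      subst hq1
      simp only [zero_mul, Complex.ofReal_zero, Complex.ofReal_one, one_mul, zero_add, hnorm]
      positivity
    · refine (mul_lt_mul_of_pos_left hy hp').trans_le ?_
      refine le_of_sq_le_sq ?_ (norm_nonneg _)
      nlinarith [sq_nonneg (q * (t * ‖w‖))]
  have h1 := hadd _ _ hseg
  have h2 := hLw t ht0 0 (by rw [norm_zero, hnorm]; positivity)
  have h3 := hLw t ht0 (z • (1 : A) + y) (by rw [hnorm]; exact ht)
  rw [add_zero] at h2
  rw [add_comm] at h3
  rw [h3, h2, map_add] at h1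
  exact (add_right_cancel h1).symm

/-- Two quarter turns suffice: from the positive axis to the right half-plane, then from `±I` to the
upper and lower half-planes. -/
theorem eq_linear_of_eqOn_unitCone [CompleteSpace A] {S : A → B} (hG : IsOpen (G : Set Aˣ))
    (hadd : ∀ a b : A, segment ℝ a b ⊆ G.unitsSet → S (a + b) = S a + S b) (L : A →ₗᵢ[ℝ] B)
    (hL : ∀ a ∈ unitCone A, S a = L a) (z : ℂ) {y : A} (hy : ‖y‖ < ‖z‖) :
    S (z • (1 : A) + y) = L (z • (1 : A) + y) := by
  have hright : ∀ z : ℂ, 0 ≤ z.re → ∀ y : A, ‖y‖ < ‖z‖ →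
      S (z • (1 : A) + y) = L (z • (1 : A) + y) := by
    intro z hz y hy
    refine eq_linear_of_inner_nonneg hG hadd L one_ne_zero (fun t ht y hy => hL _ ?_)
      (by simpa using hz) hy
    refine ⟨t, ?_⟩
    simpa [abs_of_pos ht] using hy
  rcases le_total 0 z.im with h | h
  · exact eq_linear_of_inner_nonneg hG hadd L Complex.I_ne_zero
      (fun t ht y hy => hright _ (by simp) y hy) (by simpa using h) hy
  · exact eq_linear_of_inner_nonneg hG hadd L (neg_ne_zero.2 Complex.I_ne_zero)
      (fun t ht y hy => hright _ (by simp) y hy) (by simpa using h) hy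

/-- A surjective isometry between open groups of units extends, up to a translation, to a
surjective real-linear isometry of the algebras. -/
theorem exists_linearIsometryEquiv_add [NormOneClass A] [CompleteSpace A] [CompleteSpace B]
    (hG : IsOpen (G : Set Aˣ))
    (hH : IsOpen (H : Set Bˣ)) {T : A → B}
    (hT : ∀ x ∈ G.unitsSet, ∀ y ∈ G.unitsSet, dist (T x) (T y) = dist x y)
    (hTH : T '' G.unitsSet = H.unitsSet) :
    ∃ (L : A ≃ₗᵢ[ℝ] B) (u₀ : B), ∀ a ∈ G.unitsSet, T a = L a + u₀ := by
  obtain ⟨u₀, hadd⟩ := exists_map_add_of_segment_subset hG hH hT hTH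
  have hS : ∀ x ∈ G.unitsSet, ∀ y ∈ G.unitsSet, dist (T x - u₀) (T y - u₀) = dist x y :=
    fun x hx y hy => by rw [dist_sub_right, hT x hx y hy]
  obtain ⟨L₀, hL₀⟩ := exists_linearIsometry_of_map_add (S := fun a => T a - u₀) hG hS hadd
  have hsurj := surjective_of_eqOn_unitCone hH hT hTH L₀ hL₀
  refine ⟨LinearIsometryEquiv.ofSurjective L₀ hsurj, u₀, fun a ha => ?_⟩
  rw [LinearIsometryEquiv.coe_ofSurjective]
  obtain ⟨c, hc⟩ := hsurj (T a - u₀)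
  -- Compare the distance from `T (z • 1 + a)` to `T a` with that from `L (z • 1 + a)` to `L c`. The
  -- circle below has radius `(‖a‖ + 1)⁻¹` so that inversion lands in `‖a‖ < ‖z‖`.
  have key : ∀ z : ℂ, ‖a‖ < ‖z‖ → ‖z • (1 : A) - (c - a)‖ = ‖z‖ := by
    intro z hz
    have h1 := eq_linear_of_eqOn_unitCone (S := fun a => T a - u₀) hG hadd L₀ hL₀ z hz
    have h2 := hS _ (G.smul_one_add_mem_unitsSet hG hz) a ha
    rw [h1, ← hc, L₀.dist_map, dist_eq_norm, dist_eq_norm, add_sub_cancel_right, norm_smul,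
      norm_one, mul_one] at h2
    rw [← h2]
    congr 1
    abel
  have hd : c - a = 0 := by
    refine eq_zero_of_norm_one_add_smul_le (r := (‖a‖ + 1)⁻¹) (by positivity) fun z hz => ?_
    have hz0 : z ≠ 0 := by
      rw [← norm_pos_iff, hz]; positivity
    have h := key (-z⁻¹) (by rw [norm_neg, norm_inv, hz, inv_inv]; exact lt_add_one _)
    rw [show 1 + z • (c - a) = (-z) • ((-z⁻¹) • (1 : A) - (c - a)) by
      rw [smul_sub (-z), smul_smul, neg_mul_neg, mul_inv_cancel₀ hz0, one_smul, neg_smul,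
        sub_neg_eq_add], norm_smul, h, ← norm_mul, neg_mul_neg, mul_inv_cancel₀ hz0, norm_one]
  rw [sub_eq_zero] at hd
  rw [← hd, hc, hd]
  abel

/-- If a translate of an open group of units is invariant under positive scalars, then the
translation vector lies in the Jacobson radical, so it vanishes in a semisimple algebra. -/
theorem eq_zero_of_smul_sub_add_mem [CompleteSpace B] (hB : JacobsonSemisimple B)
    (hH : IsOpen (H : Set Bˣ)) {u₀ : B}
    (h : ∀ b ∈ H.unitsSet, ∀ t : ℝ, 0 < t → t • (b - u₀) + u₀ ∈ H.unitsSet) : u₀ = 0 := by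
  have hreal : ∀ b ∈ H.unitsSet, ∀ t : ℝ, 0 < t → b + (1 - t) • u₀ ∈ H.unitsSet := by
    intro b hb t ht
    have := h (t⁻¹ • b) (H.real_smul_mem_unitsSet hH (inv_ne_zero ht.ne') hb) t ht
    rw [smul_sub, smul_smul, mul_inv_cancel₀ ht.ne', one_smul] at this
    convert this using 1
    module
  have hcomplex : ∀ b ∈ H.unitsSet, ∀ z : ℂ, b + z • u₀ ∈ H.unitsSet := by
    intro b hb z
    rcases eq_or_ne z 0 with rfl | hz
    · simpa using hb
    have hn : (0 : ℝ) < ‖z‖ := norm_pos_iff.2 hz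
    have hn' : (‖z‖ : ℂ) ≠ 0 := by exact_mod_cast hn.ne'
    -- Rotating by `w` turns the real shift `1 - t = -‖z‖` into `z`.
    set w : ℂ := -(z / ‖z‖)
    have hw : w ≠ 0 := neg_ne_zero.2 (div_ne_zero hz hn')
    have h1 := hreal _ (H.smul_mem_unitsSet hH (inv_ne_zero hw) hb) (1 + ‖z‖) (by positivity)
    have h2 := H.smul_mem_unitsSet hH hw h1
    rw [smul_add, smul_smul, mul_inv_cancel₀ hw, one_smul] at h2
    convert h2 using 2
    rw [← Complex.coe_smul, smul_smul]
    congr 1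
    simp only [w]
    push_cast
    field_simp
    ring
  refine hB.eq_zero fun x => Subgroup.isUnit_of_mem_unitsSet (G := H) ?_
  obtain ⟨r, hr⟩ := exists_gt ‖x‖
  have hk : x + r • (1 : B) ∈ H.unitsSet :=
    unitCone_subset_unitsSet hH (add_smul_one_mem_unitCone hr)
  -- With `k = x + r • 1`, the product `k * (k' * (1 - r • u₀) + u₀)` equals `1 + x * u₀`.
  obtain ⟨k', hk', hkk', -⟩ := H.exists_inv_mem_unitsSet hk
  have h1 := hcomplex 1 H.one_mem_unitsSet (-(r : ℂ))
  have h2 := H.mul_mem_unitsSet hk (hcomplex _ (H.mul_mem_unitsSet hk' h1) 1)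
  rw [one_smul, mul_add, ← mul_assoc, hkk', one_mul, add_mul, neg_smul, Complex.coe_smul,
    smul_mul_assoc, one_mul] at h2
  convert h2 using 1
  abel

/-- A surjective isometry between open groups of units, the target algebra being semisimple,
extends to a surjective real-linear isometry of the algebras. -/
theorem exists_linearIsometryEquiv_eqOn [NormOneClass A] [CompleteSpace A] [CompleteSpace B]
    (hB : JacobsonSemisimple B)
    (hG : IsOpen (G : Set Aˣ)) (hH : IsOpen (H : Set Bˣ)) {T : A → B}
    (hT : ∀ x ∈ G.unitsSet, ∀ y ∈ G.unitsSet, dist (T x) (T y) = dist x y)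
    (hTH : T '' G.unitsSet = H.unitsSet) :
    ∃ L : A ≃ₗᵢ[ℝ] B, ∀ a ∈ G.unitsSet, T a = L a := by
  obtain ⟨L, u₀, hL⟩ := exists_linearIsometryEquiv_add hG hH hT hTH
  have hu : u₀ = 0 := by
    refine eq_zero_of_smul_sub_add_mem hB hH fun b hb t ht => ?_
    rw [← hTH] at hb
    obtain ⟨a, ha, rfl⟩ := hb
    have hta := G.real_smul_mem_unitsSet hG ht.ne' ha
    rw [hL a ha, add_sub_cancel_right, ← map_smul, ← hL _ hta, ← hTH]
    exact mem_image_of_mem T hta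
  exact ⟨L, fun a ha => by rw [hL a ha, hu, add_zero]⟩

end Extension

/-! ### Zero-free entire functions of exponential type -/

section Entire

/-- An entire function of at most linear growth with value `0` at `0` is linear. -/
theorem exists_eq_mul_of_entire_of_norm_le {g : ℂ → ℂ} (hg : Differentiable ℂ g)
    (hg0 : g 0 = 0) {a b : ℝ} (ha : 0 ≤ a) (hb : 0 ≤ b) (h : ∀ z, ‖g z‖ ≤ a + b * ‖z‖) :
    ∃ c : ℂ, ∀ z, g z = c * z := by
  have hbound : ∀ w, ‖deriv g w‖ ≤ a + 2 * b := by
    intro w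
    have hR : 0 < ‖w‖ + 1 := by positivity
    refine (Complex.norm_deriv_le_of_forall_mem_sphere_norm_le (C := (a + 2 * b) * (‖w‖ + 1)) hR
      hg.diffContOnCl fun z hz => ?_).trans ?_
    · have hz' : ‖z‖ ≤ 2 * (‖w‖ + 1) := by
        have h1 : ‖z - w‖ = ‖w‖ + 1 := by simpa [dist_eq_norm] using hz
        have h2 := norm_le_norm_add_norm_sub' z w
        linarith
      refine (h z).trans ?_
      nlinarith [mul_le_mul_of_nonneg_left hz' hb, norm_nonneg w]
    · rw [mul_div_cancel_right₀ _ hR.ne']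
  obtain ⟨c, hc⟩ := hg.deriv.exists_const_forall_eq_of_bounded
    (isBounded_iff_forall_norm_le.2 ⟨_, forall_mem_range.2 hbound⟩)
  refine ⟨c, fun z => ?_⟩
  have hd : Differentiable ℂ fun z => g z - c * z := by fun_prop
  have h0 : ∀ z, deriv (fun z => g z - c * z) z = 0 := fun z => by
    rw [deriv_fun_sub hg.differentiableAt (by fun_prop), hc, deriv_const_mul_field]
    simp
  have := is_const_of_deriv_eq_zero hd h0 z 0
  simpa [hg0, sub_eq_zero] using this

/-- A zero-free entire function of exponential type is an exponential. -/
theorem exists_eq_mul_exp_of_entire {h : ℂ → ℂ} (hh : Differentiable ℂ h)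
    (hne : ∀ z, h z ≠ 0) {C k : ℝ} (hk : 0 ≤ k) (hbd : ∀ z, ‖h z‖ ≤ C * Real.exp (k * ‖z‖)) :
    ∃ c : ℂ, ∀ z, h z = h 0 * Complex.exp (c * z) := by
  have hquot : Differentiable ℂ fun z => deriv h z / h z := hh.deriv.div hh hne
  -- A primitive of `h' / h` is a logarithm of `h / h 0`; Borel–Carathéodory turns the bound on its
  -- real part into linear growth.
  obtain ⟨g, hg0, hg'⟩ := hquot.isExactOn_univ.with_val_at 0 0
  have hg : Differentiable ℂ g := fun z => (hg' z (mem_univ z)).differentiableAt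
  have hexp : ∀ z, h z = h 0 * Complex.exp (g z) := by
    intro z
    have hd : ∀ z, HasDerivAt (fun z => h z * Complex.exp (-g z)) 0 z := by
      intro z
      have h1 := (hh z).hasDerivAt.mul ((hg' z (mem_univ z)).neg.cexp)
      convert! h1 using 1
      field_simp [hne z]
      ring
    have := is_const_of_deriv_eq_zero (fun z => (hd z).differentiableAt) (fun z => (hd z).deriv) z 0
    simp only [hg0, neg_zero, Complex.exp_zero, mul_one] at this
    rw [← this, mul_assoc, ← Complex.exp_add, neg_add_cancel, Complex.exp_zero, mul_one]
  have h0 : 0 < ‖h 0‖ := norm_pos_iff.2 (hne 0)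
  have hC : 0 < C := by
    have := hbd 0
    simp only [norm_zero, mul_zero, Real.exp_zero, mul_one] at this
    linarith
  set M₀ : ℝ := |Real.log (C / ‖h 0‖)| + 1
  have hM₀ : 0 < M₀ := by positivity
  have hre : ∀ z, (g z).re ≤ M₀ + k * ‖z‖ := by
    intro z
    have h1 := hbd z
    rw [hexp z, norm_mul, Complex.norm_exp] at h1
    have h2 : Real.exp (g z).re ≤ C / ‖h 0‖ * Real.exp (k * ‖z‖) := by
      rw [div_mul_eq_mul_div, le_div_iff₀ h0]; linarith
    have h3 := Real.log_le_log (Real.exp_pos _) h2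
    rw [Real.log_exp, Real.log_mul (by positivity) (by positivity), Real.log_exp] at h3
    have := le_abs_self (Real.log (C / ‖h 0‖))
    simp only [M₀]
    linarith
  have hnorm : ∀ z, ‖g z‖ ≤ (2 * M₀ + 2 * k) + (4 * k + 2 * M₀) * ‖z‖ := by
    intro z
    have hR : 0 < 2 * ‖z‖ + 1 := by positivity
    have hbc := Complex.borelCaratheodory_zero (f := g) (R := 2 * ‖z‖ + 1) (z := z)
      (M := M₀ + k * (2 * ‖z‖ + 1)) (by positivity) hg.differentiableOn (fun w hw => ?_) hR
      (by rw [mem_ball_zero_iff]; linarith [norm_nonneg z]) hg0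
    · refine hbc.trans ?_
      rw [div_le_iff₀ (by linarith [norm_nonneg z])]
      have := norm_nonneg z
      have h1 : 0 ≤ k * ‖z‖ := by positivity
      have h2 : 0 ≤ M₀ * ‖z‖ := by positivity
      have h3 : 0 ≤ k * ‖z‖ * ‖z‖ := by positivity
      have h4 : 0 ≤ M₀ * ‖z‖ * ‖z‖ := by positivity
      nlinarith
    · refine (hre w).trans ?_
      have : ‖w‖ ≤ 2 * ‖z‖ + 1 := (mem_ball_zero_iff.1 hw).le
      gcongr
  obtain ⟨c, hc⟩ := exists_eq_mul_of_entire_of_norm_le hg hg0 (by positivity) (by positivity) hnorm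
  exact ⟨c, fun z => by rw [hexp z, hc z]⟩

end Entire

/-! ### Gleason–Kahane–Żelazko for real-linear functionals -/

section Functionals

variable {B : Type*} [NormedRing B] [NormedAlgebra ℂ B]

theorem norm_exp_le_exp_norm_of_normOneClass [NormOneClass B] (x : B) :
    ‖NormedSpace.exp x‖ ≤ Real.exp ‖x‖ := by
  let _ : NormedAlgebra ℚ B := NormedAlgebra.restrictScalars ℚ ℂ B
  rw [NormedSpace.exp_eq_tsum ℂ]
  have hs : HasSum (fun n : ℕ => ‖x‖ ^ n / n.factorial) (Real.exp ‖x‖) := by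
    rw [Real.exp_eq_exp_ℝ]
    exact NormedSpace.expSeries_div_hasSum_exp ‖x‖
  refine tsum_of_norm_bounded hs fun n => ?_
  rw [norm_smul, norm_inv, Complex.norm_natCast, div_eq_inv_mul]
  gcongr
  exact norm_pow_le x n

/-- A linear functional without zeros on exponentials is multiplicative on squares. -/
theorem map_mul_self_of_map_exp_ne_zero [NormOneClass B] [CompleteSpace B] (φ : B →L[ℂ] ℂ)
    (b : B)
    (h : ∀ z : ℂ, φ (NormedSpace.exp (z • b)) ≠ 0) : φ 1 * φ (b * b) = φ b * φ b := by
  have hd : ∀ (x : B) (z : ℂ), HasDerivAt (fun z : ℂ => φ (x * NormedSpace.exp (z • b)))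
      (φ (x * b * NormedSpace.exp (z • b))) z := by
    intro x z
    have := (φ.hasFDerivAt.comp_hasDerivAt z
      ((hasDerivAt_exp_smul_const' (𝕂 := ℂ) b z).const_mul x))
    rw [← mul_assoc] at this
    exact this
  -- Comparing the first two derivatives at `0` with those of `φ 1 * exp (c * z)` gives `φ b = φ 1 *
  -- c` and `φ (b * b) = φ 1 * c ^ 2`.
  obtain ⟨c, hc⟩ := exists_eq_mul_exp_of_entire (h := fun z => φ (NormedSpace.exp (z • b)))
    (C := ‖φ‖) (k := ‖b‖) (fun z => by
      have := (hd 1 z).differentiableAt; simpa only [one_mul] using this) h (norm_nonneg b) (by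
      intro z
      refine (φ.le_opNorm _).trans ?_
      gcongr
      refine (norm_exp_le_exp_norm_of_normOneClass _).trans ?_
      rw [norm_smul, mul_comm])
  have hder : ∀ z : ℂ,
      HasDerivAt (fun z : ℂ => Complex.exp (c * z)) (c * Complex.exp (c * z)) z := by
    intro z
    have := ((hasDerivAt_id z).const_mul c).cexp
    simpa [mul_comm] using this
  simp only [zero_smul, NormedSpace.exp_zero] at hc
  have h1 : ∀ z : ℂ, φ (b * NormedSpace.exp (z • b)) = φ 1 * (c * Complex.exp (c * z)) := by
    intro z
    have e := hd 1 z
    simp only [one_mul, hc] at e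
    exact e.unique ((hder z).const_mul _)
  have h2 : φ (b * b) = φ 1 * (c * c) := by
    have e := hd b 0
    simp only [h1, zero_smul, NormedSpace.exp_zero, mul_one] at e
    have := e.unique (((hder 0).const_mul c).const_mul (φ 1))
    simpa using this
  have h3 : φ b = φ 1 * c := by simpa using h1 0
  rw [h2, h3]
  ring

/-- A unital linear functional multiplicative on squares is multiplicative. -/
theorem map_mul_of_map_mul_self {R : Type*} [Ring R] [Algebra ℂ R] (θ : R →ₗ[ℂ] ℂ) (h1 : θ 1 = 1)
    (h : ∀ b, θ (b * b) = θ b * θ b) (x y : R) : θ (x * y) = θ x * θ y := by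
  have hjord : ∀ a b, θ (a * b) + θ (b * a) = 2 * (θ a * θ b) := by
    intro a b
    have := h (a + b)
    rw [show (a + b) * (a + b) = a * a + a * b + (b * a + b * b) by noncomm_ring] at this
    simp only [map_add, h] at this
    linear_combination this
  -- For `a` in the kernel, `ab + ba` and `(ab)² + (ba)² = a(bab) + (bab)a` both map to `0`.
  have hker : ∀ a, θ a = 0 → ∀ b, θ (a * b) = 0 := by
    intro a ha b
    have e1 : θ (a * b) + θ (b * a) = 0 := by rw [hjord, ha]; ring
    have e2 : θ (a * b) * θ (a * b) + θ (b * a) * θ (b * a) = 0 := by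
      rw [← h, ← h, show a * b * (a * b) = a * (b * a * b) by noncomm_ring,
        show b * a * (b * a) = b * a * b * a by noncomm_ring, hjord, ha]
      ring
    have e3 : θ (b * a) = -θ (a * b) := by linear_combination e1
    rw [e3] at e2
    have : θ (a * b) * θ (a * b) = 0 := by linear_combination e2 / 2
    simpa using this
  have := hker (x - θ x • 1) (by simp [h1]) y
  rw [sub_mul, smul_mul_assoc, one_mul, map_sub, map_smul, smul_eq_mul, sub_eq_zero] at this
  exact this

theorem map_complex_smul {f : B →L[ℝ] ℂ} (z : ℂ) (b : B) :
    f (z • b) = z.re * f b + z.im * f (Complex.I • b) := by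
  conv_lhs => rw [← Complex.re_add_im z]
  rw [add_smul, mul_smul, Complex.coe_smul, Complex.coe_smul, map_add, map_smul, map_smul]
  simp

/-- The complex-linear part of a real-linear functional. -/
noncomputable def linearPart (f : B →L[ℝ] ℂ) : B →L[ℂ] ℂ where
  toFun b := (f b - Complex.I * f (Complex.I • b)) / 2
  map_add' x y := by simp only [smul_add, map_add]; ring
  map_smul' z b := by
    simp only [RingHom.id_apply, smul_eq_mul]
    rw [smul_comm, map_complex_smul z b, map_complex_smul z (Complex.I • b), smul_smul,
      Complex.I_mul_I, neg_one_smul, map_neg]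
    conv_rhs => rw [← Complex.re_add_im z]
    linear_combination (z.im * f (Complex.I • b) / 2) * Complex.I_mul_I
  cont := by fun_prop

/-- The complex conjugate of the antilinear part of a real-linear functional. -/
noncomputable def antilinearPart (f : B →L[ℝ] ℂ) : B →L[ℂ] ℂ where
  toFun b := (starRingEnd ℂ) ((f b + Complex.I * f (Complex.I • b)) / 2)
  map_add' x y := by
    rw [← (starRingEnd ℂ).map_add, smul_add, f.map_add, f.map_add]
    congr 1
    ring
  map_smul' z b := by
    simp only [RingHom.id_apply, smul_eq_mul]
    rw [smul_comm, map_complex_smul z b, map_complex_smul z (Complex.I • b), smul_smul,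
      Complex.I_mul_I, neg_one_smul, map_neg]
    apply (starRingEnd ℂ).injective
    rw [map_mul, Complex.conj_conj, Complex.conj_conj]
    conv_rhs => rw [← Complex.re_add_im z]
    simp only [map_add, map_mul, Complex.conj_ofReal, Complex.conj_I]
    linear_combination (z.im * f (Complex.I • b) / 2) * Complex.I_mul_I
  cont := by fun_prop

theorem linearPart_apply (f : B →L[ℝ] ℂ) (b : B) :
    linearPart f b = (f b - Complex.I * f (Complex.I • b)) / 2 := rfl

theorem antilinearPart_apply (f : B →L[ℝ] ℂ) (b : B) :
    antilinearPart f b = (starRingEnd ℂ) ((f b + Complex.I * f (Complex.I • b)) / 2) := rfl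

theorem linearPart_add_conj_antilinearPart (f : B →L[ℝ] ℂ) (b : B) :
    linearPart f b + (starRingEnd ℂ) (antilinearPart f b) = f b := by
  rw [linearPart_apply, antilinearPart_apply, Complex.conj_conj]
  ring

/-- If the moduli agreed, a unimodular `l` could be chosen so that the two parts of `f (l • b)`
cancel. -/
theorem norm_linearPart_ne_of_ne_zero {f : B →L[ℝ] ℂ} {b : B}
    (hf : ∀ z : ℂ, z ≠ 0 → f (z • b) ≠ 0) : ‖linearPart f b‖ ≠ ‖antilinearPart f b‖ := by
  intro heq
  by_cases h0 : linearPart f b = 0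
  · have h0' : antilinearPart f b = 0 := by rw [← norm_eq_zero, ← heq, h0, norm_zero]
    have := linearPart_add_conj_antilinearPart f b
    rw [h0, h0', map_zero, add_zero] at this
    exact hf 1 one_ne_zero (by rw [one_smul, ← this])
  obtain ⟨l, hl⟩ := IsAlgClosed.exists_pow_nat_eq
    (-(starRingEnd ℂ) (antilinearPart f b) / linearPart f b) (n := 2) two_pos
  have hnorm : ‖l‖ = 1 := by
    have h2 : ‖l‖ ^ 2 = 1 := by
      rw [← norm_pow, hl, norm_div, norm_neg, RCLike.norm_conj, ← heq,
        div_self (norm_ne_zero_iff.2 h0)]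
    exact (pow_eq_one_iff_of_nonneg (norm_nonneg l) two_ne_zero).1 h2
  have hl0 : l ≠ 0 := norm_pos_iff.1 (hnorm ▸ one_pos)
  have hconj : l * (starRingEnd ℂ) l = 1 := by
    rw [Complex.mul_conj, Complex.normSq_eq_norm_sq, hnorm]; simp
  refine hf l hl0 ?_
  rw [← linearPart_add_conj_antilinearPart, map_smul, map_smul, smul_eq_mul, smul_eq_mul, map_mul]
  rw [eq_div_iff h0] at hl
  apply mul_left_cancel₀ hl0
  linear_combination hl + (starRingEnd ℂ) (antilinearPart f b) * hconj

variable {H : Subgroup Bˣ}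

theorem exp_mem_unitsSet [CompleteSpace B] (hH : IsOpen (H : Set Bˣ)) (b : B) :
    NormedSpace.exp b ∈ H.unitsSet := by
  let _ : NormedAlgebra ℚ B := NormedAlgebra.restrictScalars ℚ ℂ B
  have hc : Continuous fun t : ℝ => NormedSpace.exp (t • b) :=
    NormedSpace.exp_continuous.comp (by fun_prop)
  refine H.subset_unitsSet_of_isPreconnected hH (isPreconnected_range hc) ?_ ?_ ⟨1, by simp⟩
  · rintro _ ⟨t, rfl⟩
    exact NormedSpace.isUnit_exp _
  · exact ⟨1, ⟨0, by simp⟩, H.one_mem_unitsSet⟩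

/-- Gleason-Kahane-Zelazko theorem for real-linear functionals, the orientation preserving case. -/
theorem exists_algHom_of_ne_zero_of_pos [NormOneClass B] [CompleteSpace B]
    (hH : IsOpen (H : Set Bˣ))
    {f : B →L[ℝ] ℂ} (h1 : f 1 = 1) {β : ℝ} (hβ : 0 < β) (hI : f (Complex.I • 1) = β * Complex.I)
    (hf : ∀ b ∈ H.unitsSet, f b ≠ 0) :
    ∃ θ : B →ₐ[ℂ] ℂ, ∀ b, f b = (θ b).re + β * (θ b).im * Complex.I := by
  let _ : NormedAlgebra ℚ B := NormedAlgebra.restrictScalars ℚ ℂ B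
  set φ := linearPart f
  set ψ := antilinearPart f
  have hφ1 : φ 1 = ((1 + β) / 2 : ℝ) := by
    rw [linearPart_apply, h1, hI]
    push_cast
    linear_combination (-β / 2 : ℂ) * Complex.I_mul_I
  have hψ1 : ψ 1 = ((1 - β) / 2 : ℝ) := by
    rw [antilinearPart_apply, h1, hI,
      show (1 + Complex.I * (β * Complex.I)) / 2 = (((1 - β) / 2 : ℝ) : ℂ) by
        push_cast; linear_combination (β / 2 : ℂ) * Complex.I_mul_I, Complex.conj_ofReal]
  have hexp : ∀ b : B, Continuous fun z : ℂ => NormedSpace.exp (z • b) := fun b =>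
    NormedSpace.exp_continuous.comp (by fun_prop)
  -- The moduli never agree and the plane is connected, so the order at `z = 0` persists; there it
  -- reads `|1 - β| < 1 + β`, which needs `β > 0`.
  have hlt : ∀ (b : B) (z : ℂ), ‖ψ (NormedSpace.exp (z • b))‖ < ‖φ (NormedSpace.exp (z • b))‖ := by
    intro b z
    by_contra hle
    rw [not_lt] at hle
    have hc : Continuous fun z : ℂ =>
        ‖φ (NormedSpace.exp (z • b))‖ - ‖ψ (NormedSpace.exp (z • b))‖ :=
      ((φ.continuous.comp (hexp b)).norm).sub ((ψ.continuous.comp (hexp b)).norm)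
    obtain ⟨w, hw⟩ := mem_range_of_exists_le_of_exists_ge (c := (0 : ℝ)) hc
      ⟨z, by simpa using hle⟩ ⟨0, by
        simp only [zero_smul, NormedSpace.exp_zero, hφ1, hψ1, Complex.norm_real, Real.norm_eq_abs,
          sub_nonneg]
        rw [abs_of_pos (by positivity : 0 < (1 + β) / 2), abs_le]
        constructor <;> linarith⟩
    exact norm_linearPart_ne_of_ne_zero (f := f) (b := NormedSpace.exp (w • b))
      (fun z hz => hf _ (H.smul_mem_unitsSet hH hz (exp_mem_unitsSet hH _))) (sub_eq_zero.1 hw)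
  have hne : ∀ (b : B) (z : ℂ), φ (NormedSpace.exp (z • b)) ≠ 0 := fun b z =>
    norm_pos_iff.1 ((norm_nonneg _).trans_lt (hlt b z))
  have hφ1ne : φ 1 ≠ 0 := by simpa using hne 0 0
  have hψ : ∀ b, ψ b * φ 1 = ψ 1 * φ b := by
    intro b
    have hder : ∀ χ : B →L[ℂ] ℂ, HasDerivAt (fun z : ℂ => χ (NormedSpace.exp (z • b))) (χ b) 0 := by
      intro χ
      have := χ.hasFDerivAt.comp_hasDerivAt 0 (hasDerivAt_exp_smul_const (𝕂 := ℂ) b 0)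
      simpa using! this
    have hdiff : ∀ χ : B →L[ℂ] ℂ, Differentiable ℂ fun z : ℂ => χ (NormedSpace.exp (z • b)) :=
      fun χ => χ.differentiable.comp (differentiable_exp_smul_const ℂ b)
    -- Liouville: the quotient is entire and bounded by `1`, hence constant.
    obtain ⟨k, hk⟩ := ((hdiff ψ).div (hdiff φ) (hne b)).exists_const_forall_eq_of_bounded
      (isBounded_iff_forall_norm_le.2 ⟨1, forall_mem_range.2 fun z => by
        simp only [Pi.div_apply, norm_div]
        exact div_le_one_of_le₀ (hlt b z).le (norm_nonneg _)⟩)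
    have hk' : ∀ z, ψ (NormedSpace.exp (z • b)) = k * φ (NormedSpace.exp (z • b)) := fun z => by
      rw [← hk z, Pi.div_apply, div_mul_cancel₀ _ (hne b z)]
    have e1 : ψ 1 = k * φ 1 := by simpa using hk' 0
    have e2 : ψ b = k * φ b := by
      have := hder ψ
      simp only [hk'] at this
      exact this.unique ((hder φ).const_mul k)
    rw [e1, e2]
    ring
  let θ₀ : B →ₗ[ℂ] ℂ := (φ 1)⁻¹ • (φ : B →ₗ[ℂ] ℂ)
  have hθ₀ : ∀ b, θ₀ b = (φ 1)⁻¹ * φ b := fun b => rfl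
  have hθ1 : θ₀ 1 = 1 := by rw [hθ₀, inv_mul_cancel₀ hφ1ne]
  let θ : B →ₐ[ℂ] ℂ := AlgHom.ofLinearMap θ₀ hθ1 (map_mul_of_map_mul_self θ₀ hθ1 fun b => by
    rw [hθ₀, hθ₀]
    field_simp
    linear_combination map_mul_self_of_map_exp_ne_zero φ b (hne b))
  refine ⟨θ, fun b => ?_⟩
  have hφb : φ b = ((1 + β) / 2 : ℝ) * θ b := by
    rw [← hφ1, show θ b = (φ 1)⁻¹ * φ b from rfl, mul_inv_cancel_left₀ hφ1ne]
  have hψb : ψ b = ((1 - β) / 2 : ℝ) * θ b := by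
    rw [← hψ1, show θ b = (φ 1)⁻¹ * φ b from rfl]
    field_simp
    linear_combination hψ b
  rw [← linearPart_add_conj_antilinearPart f b]
  change φ b + (starRingEnd ℂ) (ψ b) = _
  rw [hφb, hψb, map_mul, Complex.conj_ofReal]
  apply Complex.ext <;> simp <;> ring

/-- Gleason-Kahane-Zelazko theorem for real-linear functionals. -/
theorem exists_algHom_of_ne_zero [NormOneClass B] [CompleteSpace B] (hH : IsOpen (H : Set Bˣ))
    {f : B →L[ℝ] ℂ} (h1 : f 1 = 1) {β : ℝ} (hI : f (Complex.I • 1) = β * Complex.I)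
    (hf : ∀ b ∈ H.unitsSet, f b ≠ 0) :
    ∃ θ : B →ₐ[ℂ] ℂ, ∀ b, f b = (θ b).re + β * (θ b).im * Complex.I := by
  have hβ : β ≠ 0 := by
    rintro rfl
    exact hf _ (H.smul_one_mem_unitsSet hH Complex.I_ne_zero) (by simp [hI])
  rcases hβ.lt_or_gt with hneg | hpos
  -- Conjugating `f` changes the sign of `β`.
  · have hg : ∀ b, ((Complex.conjCLE : ℂ →L[ℝ] ℂ).comp f) b = (starRingEnd ℂ) (f b) := fun b => rfl
    obtain ⟨θ, hθ⟩ := exists_algHom_of_ne_zero_of_pos hH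
      (f := (Complex.conjCLE : ℂ →L[ℝ] ℂ).comp f) (by rw [hg, h1, map_one])
      (β := -β) (by linarith) (by rw [hg, hI]; simp) (fun b hb => by
        rw [hg]
        exact (map_ne_zero _).2 (hf b hb))
    refine ⟨θ, fun b => ?_⟩
    have := hθ b
    rw [hg] at this
    apply (starRingEnd ℂ).injective
    rw [this]
    apply Complex.ext <;> simp
  · exact exists_algHom_of_ne_zero_of_pos hH h1 hpos hI hf

end Functionals

/-! ### Characters and multiplicativity -/

section Characters

/-- A complex number `w` for which `x + y I ↦ x + y w` is a contraction is purely imaginary. -/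
theorem re_eq_zero_of_norm_add_mul_le {w : ℂ}
    (h : ∀ x y : ℝ, ‖(x : ℂ) + y * w‖ ≤ ‖(x : ℂ) + y * Complex.I‖) : w.re = 0 := by
  by_contra hne
  -- This choice makes the cross term in the squared norm equal to `2`, while the right side gains
  -- only `1`.
  have h1 := h (1 / w.re) 1
  have h2 := pow_le_pow_left₀ (norm_nonneg _) h1 2
  rw [← Complex.normSq_eq_norm_sq, ← Complex.normSq_eq_norm_sq, Complex.normSq_apply,
    Complex.normSq_apply] at h2
  simp only [Complex.add_re, Complex.ofReal_re, Complex.mul_re, Complex.ofReal_im, Complex.add_im,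
    Complex.mul_im, Complex.I_re, Complex.I_im] at h2
  have h3 : 1 / w.re * w.re = 1 := one_div_mul_cancel hne
  nlinarith [sq_nonneg w.re, sq_nonneg w.im]

variable {A B : Type*} [NormedCommRing A] [NormedAlgebra ℂ A]
  [NormedRing B] [NormedAlgebra ℂ B] {G : Subgroup Aˣ} {H : Subgroup Bˣ}

/-- The normalized inverse of a real-linear isometry preserving groups of units is multiplicative
after composition with any character. -/
theorem character_map_mul [CompleteSpace A] [NormOneClass A] [CompleteSpace B]
    [NormOneClass B] (hH : IsOpen (H : Set Bˣ)) (L : A ≃ₗᵢ[ℝ] B)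
    (hL : ∀ b ∈ H.unitsSet, L.symm b ∈ G.unitsSet) {v : B}
    (hu : L 1 ∈ H.unitsSet) (huv : L 1 * v = 1) (χ : A →ₐ[ℂ] ℂ) (x y : B) :
    χ (L.symm (L 1 * (x * y))) = χ (L.symm (L 1 * x)) * χ (L.symm (L 1 * y)) := by
  have hχ : Continuous χ := map_continuous χ
  have hnorm1 : ‖L 1‖ = 1 := by rw [L.norm_map, norm_one]
  let f : B →L[ℝ] ℂ :=
    { toFun := fun b => χ (L.symm (L 1 * b))
      map_add' := fun x y => by rw [mul_add, map_add, map_add]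
      map_smul' := fun r x => by
        rw [mul_smul_comm, map_smul, RingHom.id_apply, ← Complex.coe_smul, map_smul,
          Complex.coe_smul]
      cont := hχ.comp (L.symm.continuous.comp (continuous_const.mul continuous_id)) }
  have hf : ∀ b, f b = χ (L.symm (L 1 * b)) := fun b => rfl
  have h1 : f 1 = 1 := by rw [hf, mul_one, L.symm_apply_apply, map_one]
  have hle : ∀ b, ‖χ (L.symm b)‖ ≤ ‖b‖ := fun b =>
    (AlgHom.norm_apply_le_self χ _).trans_eq (L.symm.norm_map b)
  have hfle : ∀ z : ℂ, ‖f (z • 1)‖ ≤ ‖z‖ := fun z => by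
    rw [hf]
    refine (hle _).trans ?_
    rw [mul_smul_comm, mul_one, norm_smul, hnorm1, mul_one]
  set w := f (Complex.I • 1) with hw
  have hwre : w.re = 0 := by
    refine re_eq_zero_of_norm_add_mul_le fun x y => ?_
    have := hfle (x + y * Complex.I)
    rw [map_complex_smul, h1] at this
    simpa using this
  have hwI : f (Complex.I • 1) = (w.im : ℂ) * Complex.I := by
    rw [← hw]
    apply Complex.ext <;> simp [hwre]
  set β := w.im
  obtain ⟨θ, hθ⟩ := exists_algHom_of_ne_zero hH h1 hwI fun b hb => by
    rw [hf]
    exact ((Subgroup.isUnit_of_mem_unitsSet (hL _ (H.mul_mem_unitsSet hu hb))).map χ).ne_zero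
  have hfv : ∀ b, χ (L.symm b) = f (v * b) := fun b => by rw [hf, ← mul_assoc, huv, one_mul]
  -- No bound on `‖v‖` is at hand. Testing at `conj (θ v) • 1` makes the `θ`-value real, so `β`
  -- drops out and `‖θ v‖ ^ 2 ≤ ‖θ v‖`.
  have hτ : ‖θ v‖ ≤ 1 := by
    have h := hle ((starRingEnd ℂ) (θ v) • 1)
    rw [hfv, mul_smul_comm, mul_one, hθ, map_smul, smul_eq_mul, mul_comm, Complex.mul_conj,
      norm_smul, norm_one, mul_one, RCLike.norm_conj, Complex.normSq_eq_norm_sq] at h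
    simp only [Complex.ofReal_re, Complex.ofReal_im, Complex.ofReal_zero, mul_zero, zero_mul,
      add_zero, Complex.norm_real, norm_pow, norm_norm] at h
    nlinarith [norm_nonneg (θ v)]
  have hβle : |β| ≤ 1 := by
    have := hfle Complex.I
    rw [hwI, norm_mul, Complex.norm_real, Complex.norm_I, mul_one] at this
    exact this
  -- Testing at `L (I • 1)`, where the value is `I`, gives `β * Im θ (v * L (I • 1)) = 1` with a
  -- second factor of modulus at most `1`.
  have hβge : 1 ≤ |β| := by
    have h := hfv (L (Complex.I • 1))
    rw [L.symm_apply_apply, map_smul, map_one, smul_eq_mul, mul_one, hθ] at h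
    have him := congrArg Complex.im h
    have him' : β * (θ (v * L (Complex.I • 1))).im = 1 := by simpa using him.symm
    have hn : ‖θ (v * L (Complex.I • 1))‖ ≤ 1 := by
      rw [map_mul, norm_mul]
      have h2 : ‖θ (L (Complex.I • 1))‖ ≤ 1 := by
        refine (AlgHom.norm_apply_le_self θ _).trans ?_
        rw [L.norm_map, norm_smul, norm_one, Complex.norm_I, mul_one]
      exact mul_le_one₀ hτ (norm_nonneg _) h2
    have hc := (Complex.abs_im_le_norm (θ (v * L (Complex.I • 1)))).trans hn
    have := congrArg abs him'
    rw [abs_mul, abs_one] at this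
    nlinarith [abs_nonneg β]
  have hβ : β = 1 ∨ β = -1 := eq_or_eq_neg_of_abs_eq (le_antisymm hβle hβge)
  rw [← hf, ← hf, ← hf, hθ, hθ, hθ, map_mul]
  rcases hβ with hβ | hβ <;> rw [hβ] <;> apply Complex.ext <;> simp <;> ring

/-- An element annihilated by all characters can be added to the unit inside every open group of
units. -/
theorem one_add_mem_unitsSet_of_character_eq_zero [CompleteSpace A]
    (hG : IsOpen (G : Set Aˣ)) {a : A}
    (ha : ∀ χ : A →ₐ[ℂ] ℂ, χ a = 0) : 1 + a ∈ G.unitsSet := by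
  have hc : Continuous fun t : ℝ => 1 + t • a := by fun_prop
  refine G.subset_unitsSet_of_isPreconnected hG (isPreconnected_range hc) ?_ ?_ ⟨1, by simp⟩
  · rintro _ ⟨t, rfl⟩
    -- Gelfand theory: in a commutative algebra every non-unit is killed by a character.
    by_contra hu
    obtain ⟨χ, hχ⟩ := WeakDual.CharacterSpace.exists_apply_eq_zero hu
    have h := ha (WeakDual.CharacterSpace.toAlgHom χ)
    have h' : χ a = 0 := h
    rw [map_add, map_one, ← Complex.coe_smul, map_smul, h', smul_zero, add_zero] at hχ
    exact one_ne_zero hχ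
  · exact ⟨1, ⟨0, by simp⟩, G.one_mem_unitsSet⟩

/-- A real-linear isometry of a commutative algebra onto a semisimple one that preserves open
groups of units becomes an algebra isomorphism after division by its value at the unit. -/
theorem exists_algEquiv_of_linearIsometryEquiv [CompleteSpace A] [NormOneClass A]
    [CompleteSpace B] [NormOneClass B] (hB : JacobsonSemisimple B)
    (hG : IsOpen (G : Set Aˣ)) (hH : IsOpen (H : Set Bˣ)) (L : A ≃ₗᵢ[ℝ] B)
    (hLG : ∀ a ∈ G.unitsSet, L a ∈ H.unitsSet) (hLH : ∀ b ∈ H.unitsSet, L.symm b ∈ G.unitsSet)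
    {v : B} (hv : v ∈ H.unitsSet) (huv : L 1 * v = 1) (hvu : v * L 1 = 1) :
    ∃ Φ : A ≃ₐ[ℝ] B, ∀ a, Φ a = v * L a := by
  have hu : L 1 ∈ H.unitsSet := hLG 1 G.one_mem_unitsSet
  have hmul := character_map_mul hH L hLH hu huv
  let Φ₀ : A ≃ₗ[ℝ] B :=
    { toFun := fun a => v * L a
      map_add' := fun x y => by rw [map_add, mul_add]
      map_smul' := fun r x => by rw [map_smul, mul_smul_comm, RingHom.id_apply]
      invFun := fun b => L.symm (L 1 * b)
      left_inv := fun a => by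
        simp only
        rw [← mul_assoc, huv, one_mul, L.symm_apply_apply]
      right_inv := fun b => by
        simp only
        rw [L.apply_symm_apply, ← mul_assoc, hvu, one_mul] }
  have hΦ₀ : ∀ a, Φ₀ a = v * L a := fun a => rfl
  have hsymm : ∀ b, Φ₀.symm b = L.symm (L 1 * b) := fun b => rfl
  have hΦ1 : Φ₀ 1 = 1 := by rw [hΦ₀, hvu]
  -- The hypothesis passes from `b` to every `x * b` by `hmul`, so `1 + x * b` is a unit for all
  -- `x`.
  have hzero : ∀ b, (∀ χ : A →ₐ[ℂ] ℂ, χ (Φ₀.symm b) = 0) → b = 0 := by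
    intro b hb
    refine hB.eq_zero fun x => Subgroup.isUnit_of_mem_unitsSet (G := H) ?_
    have h := one_add_mem_unitsSet_of_character_eq_zero hG (a := Φ₀.symm (x * b)) fun χ => by
      rw [hsymm, hmul, ← hsymm b, hb, mul_zero]
    have h' := H.mul_mem_unitsSet hv (hLG _ h)
    rwa [← hΦ₀, map_add, hΦ1, Φ₀.apply_symm_apply] at h'
  refine ⟨AlgEquiv.ofLinearEquiv Φ₀ hΦ1 fun a b => ?_, hΦ₀⟩
  rw [← sub_eq_zero]
  refine hzero _ fun χ => ?_
  rw [map_sub, Φ₀.symm_apply_apply, map_sub, hsymm (Φ₀ a * Φ₀ b), hmul, ← hsymm, ← hsymm,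
    Φ₀.symm_apply_apply, Φ₀.symm_apply_apply, map_mul, sub_self]

/-- A real algebra isomorphism is isometric if its product with some element is a linear isometry
that maps the unit to that element. -/
theorem isometry_of_mul_eq_linearIsometryEquiv [NormOneClass A] [NormOneClass B]
    (L : A ≃ₗᵢ[ℝ] B) {v : B} (huv : L 1 * v = 1)
    (Φ : A ≃ₐ[ℝ] B) (hΦ : ∀ a, Φ a = v * L a) : Isometry Φ := by
  have hL : ∀ a, L a = L 1 * Φ a := fun a => by rw [hΦ, ← mul_assoc, huv, one_mul]
  refine AddMonoidHomClass.isometry_of_norm Φ fun a => le_antisymm ?_ ?_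
  -- `Φ a = L (Φ⁻¹ v * a)`, and `L` sends `Φ⁻¹ v` to `1`.
  · have h1 : ‖Φ.symm v‖ = 1 := by
      rw [← L.norm_map, hL, Φ.apply_symm_apply, huv, norm_one]
    have h2 : Φ a = L (Φ.symm v * a) := by
      rw [hL, map_mul, Φ.apply_symm_apply, ← mul_assoc, huv, one_mul]
    rw [h2, L.norm_map]
    refine (norm_mul_le _ _).trans ?_
    rw [h1, one_mul]
  · rw [← L.norm_map a, hL]
    refine (norm_mul_le _ _).trans ?_
    rw [L.norm_map, norm_one, one_mul]

end Characters

/-! ### Transfer along the isomorphism and conclusion -/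

theorem JacobsonSemisimple.of_ringEquiv {R S : Type*} [Ring R] [Ring S] (e : R ≃+* S)
    (hS : JacobsonSemisimple S) : JacobsonSemisimple R := by
  have : RingHomSurjective (e : R →+* S) := ⟨e.surjective⟩
  refine eq_bot_iff.2 fun a ha => ?_
  have h := Ring.le_comap_jacobson (e : R →+* S) ha
  rw [Ideal.mem_comap, show Ring.jacobson S = ⊥ from hS, Ideal.mem_bot] at h
  exact (map_eq_zero_iff e e.injective).1 h

theorem corollary5p2 {A B : Type*}
    [NormedCommRing A] [NormedAlgebra ℂ A] [CompleteSpace A] [NormOneClass A]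
    [NormedRing B] [NormedAlgebra ℂ B] [CompleteSpace B] [NormOneClass B]
    (hB : JacobsonSemisimple B)
    (𝔄 : Subgroup Aˣ) (h𝔄 : IsOpen (𝔄 : Set Aˣ))
    (𝔅 : Subgroup Bˣ) (h𝔅 : IsOpen (𝔅 : Set Bˣ))
    (T : 𝔄 → 𝔅) (hT_surj : Function.Surjective T)
    (hT_isom : ∀ a b : 𝔄, dist ((T a : Bˣ) : B) ((T b : Bˣ) : B) = dist ((a : Aˣ) : A) ((b : Aˣ) : A)) :
    (∃ Φ : A ≃ₐ[ℝ] B, Isometry Φ ∧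
      ∀ a : 𝔄, Φ ((a : Aˣ) : A) = (((T 1 : Bˣ)⁻¹ : Bˣ) : B) * ((T a : Bˣ) : B)) ∧
    JacobsonSemisimple A ∧
    (∀ x y : B, x * y = y * x) ∧
    (∃ Ψ : Aˣ ≃* Bˣ, ∀ a b : Aˣ, dist (Ψ a : B) (Ψ b : B) = dist (a : A) (b : A)) := by
  have hinj : Function.Injective fun a : 𝔄 => ((a : Aˣ) : A) :=
    Units.val_injective.comp Subtype.val_injective
  -- The value `0` off `𝔄` is never used.
  let T₀ : A → B := Function.extend (fun a : 𝔄 => ((a : Aˣ) : A))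
    (fun a => ((T a : Bˣ) : B)) 0
  have hT₀ : ∀ a : 𝔄, T₀ ((a : Aˣ) : A) = ((T a : Bˣ) : B) := fun a => hinj.extend_apply _ _ a
  have hiso : ∀ x ∈ 𝔄.unitsSet, ∀ y ∈ 𝔄.unitsSet, dist (T₀ x) (T₀ y) = dist x y := by
    rintro _ ⟨a, ha, rfl⟩ _ ⟨b, hb, rfl⟩
    have := hT_isom ⟨a, ha⟩ ⟨b, hb⟩
    rwa [← hT₀, ← hT₀] at this
  have himage : T₀ '' 𝔄.unitsSet = 𝔅.unitsSet := by
    ext b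
    constructor
    · rintro ⟨_, ⟨a, ha, rfl⟩, rfl⟩
      exact ⟨T ⟨a, ha⟩, (T ⟨a, ha⟩).2, (hT₀ ⟨a, ha⟩).symm⟩
    · rintro ⟨g, hg, rfl⟩
      obtain ⟨a, ha⟩ := hT_surj ⟨g, hg⟩
      exact ⟨_, ⟨a, a.2, rfl⟩, (hT₀ a).trans (by rw [ha])⟩
  obtain ⟨L, hL⟩ := exists_linearIsometryEquiv_eqOn hB h𝔄 h𝔅 hiso himage
  have hLT : ∀ a : 𝔄, L ((a : Aˣ) : A) = ((T a : Bˣ) : B) := fun a => by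
    rw [← hL _ ⟨a, a.2, rfl⟩, hT₀]
  have hL1 : L 1 = ((T 1 : Bˣ) : B) := hLT 1
  have hLG : ∀ a ∈ 𝔄.unitsSet, L a ∈ 𝔅.unitsSet := fun a ha => by
    rw [← hL a ha, ← himage]
    exact mem_image_of_mem T₀ ha
  have hLH : ∀ b ∈ 𝔅.unitsSet, L.symm b ∈ 𝔄.unitsSet := fun b hb => by
    rw [← himage] at hb
    obtain ⟨a, ha, rfl⟩ := hb
    rwa [hL a ha, L.symm_apply_apply]
  have hv : (((T 1 : Bˣ)⁻¹ : Bˣ) : B) ∈ 𝔅.unitsSet := ⟨_, 𝔅.inv_mem (T 1).2, rfl⟩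
  have huv : L 1 * (((T 1 : Bˣ)⁻¹ : Bˣ) : B) = 1 := by rw [hL1, Units.mul_inv]
  have hvu : (((T 1 : Bˣ)⁻¹ : Bˣ) : B) * L 1 = 1 := by rw [hL1, Units.inv_mul]
  obtain ⟨Φ, hΦ⟩ := exists_algEquiv_of_linearIsometryEquiv hB h𝔄 h𝔅 L hLG hLH hv huv hvu
  have hΦiso : Isometry Φ := isometry_of_mul_eq_linearIsometryEquiv L huv Φ hΦ
  refine ⟨⟨Φ, hΦiso, fun a => by rw [hΦ, hLT]⟩, hB.of_ringEquiv Φ.toRingEquiv, fun x y => ?_,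
    Units.mapEquiv Φ.toMulEquiv, fun a b => hΦiso.dist_eq _ _⟩
  rw [← Φ.apply_symm_apply x, ← Φ.apply_symm_apply y, ← map_mul, mul_comm, map_mul]
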